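/- Conventions. A partial multi-valued function $P :\subseteq \mathbb{N}^{\mathbb{N}} \rightrightarrows \mathbb{N}^{\mathbb{N}}$ on Baire space assigns to each $x$ a set $P(x) \subseteq \mathbb{N}^{\mathbb{N}}$; $\operatorname{dom}(P) = \{x \mid P(x) \neq \emptyset\}$, and a partial function $f$ is a choice function of $P$ if $f(x)$ is defined and $f(x) \in P(x)$ for all $x \in \operatorname{dom}(P)$. Write $P \leq_W Q$ (Weihrauch reducibility) if there are computable partial functions $H, K :\subseteq \mathbb{N}^{\mathbb{N}} \to \mathbb{N}^{\mathbb{N}}$ such that for every choice function $g$ of $Q$ the function $x \mapsto H\langle x, g(K(x))\rangle$ is a choice function of $P$. The Weihrauch degrees $\mathfrak{W}$ are the equivalence classes of this preorder, together with an additional top element $\top$. With standard tupling functions, let $(P \times Q)(\langle p, q\rangle) = \langle P(p), Q(q)\rangle$; let $P^*(n\langle p_1, \ldots, p_n\rangle) = n\langle P(p_1), \ldots, P(p_n)\rangle$ for $n \geq 1$ and $P^*(0p) = 0^{\mathbb{N}}$ (finite parallelization); and let $\widehat{P}(\langle p_1, p_2, \ldots\rangle) = \langle P(p_1), P(p_2),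 \ldots\rangle$ (parallelization). These operations are well defined on degrees, and one sets $\mathbf{a} \times \top = \top \times \mathbf{a} = \top$ and $\top^* = \widehat{\top} = \top$. A degree is pointed if it lies above the degree of the identity on $\mathbb{N}^{\mathbb{N}}$. Let $\mathfrak{W}^* = \{\mathbf{a} \in \mathfrak{W} \mid \mathbf{a}^* = \mathbf{a}\}$ and $p\widehat{\mathfrak{W}} = \{\mathbf{a} \in \mathfrak{W} \mid \mathbf{a} \text{ is pointed and } \widehat{\mathbf{a}} = \mathbf{a}\}$, ordered as in $\mathfrak{W}$; both are lattices whose binary supremum is $\times$. A lattice $\mathfrak{L}$ is a Brouwer algebra if for all $\mathbf{a}, \mathbf{b} \in \mathfrak{L}$ the set $\{\mathbf{c} \in \mathfrak{L} \mid \mathbf{b} \leq \mathbf{c} \vee \mathbf{a}\}$ has a least element. Theorem. Neither $\mathfrak{W}^*$ nor $p\widehat{\mathfrak{W}}$ is a Brouwer algebra. Moreover, there are partial multi-valued functions $P, Q$ on Baire space, both of pointed degree, such that the set $\{R \in \mathfrak{W} \mid \widehat{Q} \leq_W \widehat{P} \times R\}$ has no least element, the set of its parallelizable elements (those with $\widehat{R}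 = R$) has no least element, and the set of its elements fixed by finite parallelization (those with $R^* = R$) has no least element. -/

import Mathlib

/-! ## Computable partial functions on Baire space -/

namespace Weihrauch

/-- Baire space `ℕ^ℕ`. -/
abbrev Baire : Type := ℕ → ℕ

/-- Partial recursive functionals `Ψ(p, n)` of an oracle `p ∈ ℕ^ℕ` and a number `n`: the closure
scheme of Mathlib's `Nat.Partrec`, extended by the oracle query `n ↦ p n`.  The functional is given
by one scheme for all oracles, i.e. it is uniform in `p`. -/
inductive PartrecFunctional : (Baire → ℕ →. ℕ) → Prop
  | zero : PartrecFunctional fun _ _ => Part.some 0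
  | succ : PartrecFunctional fun _ n => Part.some (n + 1)
  | left : PartrecFunctional fun _ n => Part.some n.unpair.1
  | right : PartrecFunctional fun _ n => Part.some n.unpair.2
  | oracle : PartrecFunctional fun p n => Part.some (p n)
  | pair {f g : Baire → ℕ →. ℕ} : PartrecFunctional f → PartrecFunctional g →
      PartrecFunctional fun p n => (f p n).bind fun a => (g p n).bind fun b =>
        Part.some (Nat.pair a b)
  | comp {f g : Baire → ℕ →. ℕ} : PartrecFunctional f → PartrecFunctional g →
      PartrecFunctional fun p n => (g p n).bind fun a => f p a
  | prec {f g : Baire → ℕ →. ℕ} : PartrecFunctional f → PartrecFunctional g →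
      PartrecFunctional fun p m =>
        Nat.rec (motive := fun _ => Part ℕ) (f p m.unpair.1)
          (fun y ih => ih.bind fun i => g p (Nat.pair m.unpair.1 (Nat.pair y i))) m.unpair.2
  | rfind {f : Baire → ℕ →. ℕ} : PartrecFunctional f →
      PartrecFunctional fun p a =>
        Nat.rfind fun n => (f p (Nat.pair a n)).map fun m => decide (m = 0)

/-- With oracle `p`, the functional `Ψ` outputs the whole infinite sequence `q`. -/
def Outputs (Ψ : Baire → ℕ →. ℕ) (p q : Baire) : Prop :=
  ∀ n, Ψ p n = Part.some (q n)

/-- A partial function on Baire space is computable if some partial recursive functional outputs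
`F(p)` with oracle `p`, for each `p` in the domain of `F`. -/
def IsComputable (F : Baire →. Baire) : Prop :=
  ∃ Ψ, PartrecFunctional Ψ ∧ ∀ p, ∀ q ∈ F p, Outputs Ψ p q

/-! ## Tupling -/

/-- The sequence `n p`, i.e. `n` followed by `p`. -/
def cons (n : ℕ) (p : Baire) : Baire
  | 0 => n
  | k + 1 => p k

/-- The shift `n p ↦ p`. -/
def tail (p : Baire) : Baire := fun k => p (k + 1)

/-- The pairing `⟨p, q⟩ = p(0) q(0) p(1) q(1) …`, a bijection. -/
def pair (p q : Baire) : Baire := fun k => if k % 2 = 0 then p (k / 2) else q (k / 2)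

/-- `⟨p, q⟩ ↦ p`. -/
def fst (x : Baire) : Baire := fun k => x (2 * k)

/-- `⟨p, q⟩ ↦ q`. -/
def snd (x : Baire) : Baire := fun k => x (2 * k + 1)

/-- The `i`-th component (`i < n`) of a finite tuple
`⟨p₀, …, pₙ₋₁⟩ = p₀(0) … pₙ₋₁(0) p₀(1) … pₙ₋₁(1) …`; for `n ≥ 1` each sequence is a unique such
tuple. -/
def finProj (n i : ℕ) (x : Baire) : Baire := fun k => x (n * k + i)

/-- The finite tuple `⟨p₀, …, pₙ₋₁⟩` (for `n ≥ 1`). -/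
def finTuple (n : ℕ) (y : ℕ → Baire) : Baire := fun m => y (m % n) (m / n)

/-- The `i`-th component of a countable tuple `⟨p₀, p₁, …⟩`, where `⟨p₀, p₁, …⟩⟨i, k⟩ = pᵢ(k)`. -/
def proj (i : ℕ) (x : Baire) : Baire := fun k => x (Nat.pair i k)

/-- The countable tuple `⟨p₀, p₁, …⟩`. -/
def tuple (y : ℕ → Baire) : Baire := fun m => y m.unpair.1 m.unpair.2

/-! ## Multi-valued functions and Weihrauch reducibility -/

/-- A partial multi-valued function on Baire space; its domain is the set of `x` with `P x ≠ ∅`. -/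
def Problem : Type := Baire → Set Baire

namespace Problem

/-- The domain of a partial multi-valued function. -/
def dom (P : Problem) : Set Baire := {x | (P x).Nonempty}

/-- A partial function is a choice function of `P` if it is defined on `dom P` and picks there an
element of `P x`. -/
def IsChoice (f : Baire →. Baire) (P : Problem) : Prop :=
  ∀ x ∈ P.dom, ∃ y ∈ f x, y ∈ P x

/-- Weihrauch reducibility: there are computable `H, K` such that `x ↦ H⟨x, g(K(x))⟩` is a choice
function of `P` for each choice function `g` of `Q`. -/
def Reducible (P Q : Problem) : Prop :=
  ∃ H K : Baire →. Baire, IsComputable H ∧ IsComputable K ∧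
    ∀ g : Baire →. Baire, IsChoice g Q →
      IsChoice (fun x => (K x).bind fun k => (g k).bind fun y => H (pair x y)) P

/-- The identity on Baire space. -/
def idBaire : Problem := fun x => {x}

/-- The product: `(P × Q)⟨p, q⟩ = ⟨P(p), Q(q)⟩`. -/
def times (P Q : Problem) : Problem := fun x =>
  {y | fst y ∈ P (fst x) ∧ snd y ∈ Q (snd x)}

/-- The sum: `(P ⊕ Q)⟨p, q⟩ = 0 P(p) ∪ 1 Q(q)` for `p ∈ dom P`, `q ∈ dom Q`. -/
def oplus (P Q : Problem) : Problem := fun x =>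
  {y | fst x ∈ P.dom ∧ snd x ∈ Q.dom ∧
    ((∃ z ∈ P (fst x), y = cons 0 z) ∨ ∃ z ∈ Q (snd x), y = cons 1 z)}

/-- Finite parallelization: `P*(n⟨p₁, …, pₙ⟩) = n⟨P(p₁), …, P(pₙ)⟩` for `n ≥ 1`, and
`P*(0p) = 0^ℕ`. -/
def star (P : Problem) : Problem := fun x =>
  {y | (x 0 = 0 ∧ y = fun _ => 0) ∨
    (x 0 ≠ 0 ∧ y 0 = x 0 ∧
      ∀ i < x 0, finProj (x 0) i (tail y) ∈ P (finProj (x 0) i (tail x)))}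

/-- Parallelization: `P̂⟨p₀, p₁, …⟩ = ⟨P(p₀), P(p₁), …⟩`. -/
def hat (P : Problem) : Problem := fun x => {y | ∀ i, proj i y ∈ P (proj i x)}

end Problem

/-! ## Closure properties of partial recursive functionals -/

/-- Total recursive functionals. -/
def TotalFunctional (f : Baire → ℕ → ℕ) : Prop :=
  PartrecFunctional fun p n => Part.some (f p n)

theorem PartrecFunctional.of_eq {f g : Baire → ℕ →. ℕ} (hf : PartrecFunctional f)
    (h : ∀ p n, f p n = g p n) : PartrecFunctional g := by
  have : f = g := by funext p n; exact h p n
  exact this ▸ hf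

theorem PartrecFunctional.of_partrec {f : ℕ →. ℕ} (hf : Nat.Partrec f) :
    PartrecFunctional fun _ => f := by
  induction hf with
  | zero => exact .zero
  | succ => exact .succ
  | left => exact .left
  | right => exact .right
  | pair _ _ h1 h2 =>
    refine (h1.pair h2).of_eq fun p n => ?_
    simp [Seq.seq, Part.bind_some_eq_map, Part.bind_map]
  | comp _ _ h1 h2 => exact h1.comp h2
  | prec _ _ h1 h2 => exact h1.prec h2
  | rfind _ h1 => exact h1.rfind

theorem TotalFunctional.of_primrec {g : ℕ → ℕ} (hg : Primrec g) :
    TotalFunctional fun _ n => g n :=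
  .of_partrec (Nat.Partrec.of_primrec (Primrec.nat_iff.1 hg))

theorem PartrecFunctional.at {f : Baire → ℕ →. ℕ} {g : Baire → ℕ → ℕ}
    (hf : PartrecFunctional f) (hg : TotalFunctional g) :
    PartrecFunctional fun p n => f p (g p n) :=
  (hf.comp hg).of_eq fun p n => by simp

theorem TotalFunctional.at {f g : Baire → ℕ → ℕ} (hf : TotalFunctional f)
    (hg : TotalFunctional g) : TotalFunctional fun p n => f p (g p n) :=
  PartrecFunctional.at (f := fun p n => Part.some (f p n)) hf hg

theorem TotalFunctional.map {g : ℕ → ℕ} {f : Baire → ℕ → ℕ} (hg : Primrec g)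
    (hf : TotalFunctional f) : TotalFunctional fun p n => g (f p n) :=
  (TotalFunctional.of_primrec hg).at hf

theorem TotalFunctional.pair {f g : Baire → ℕ → ℕ} (hf : TotalFunctional f)
    (hg : TotalFunctional g) : TotalFunctional fun p n => Nat.pair (f p n) (g p n) :=
  (PartrecFunctional.pair hf hg).of_eq fun p n => by simp

theorem TotalFunctional.map₂ {h : ℕ → ℕ → ℕ} {f g : Baire → ℕ → ℕ} (hh : Primrec₂ h)
    (hf : TotalFunctional f) (hg : TotalFunctional g) :
    TotalFunctional fun p n => h (f p n) (g p n) := by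
  have h1 : Primrec fun m : ℕ => h m.unpair.1 m.unpair.2 :=
    hh.comp (Primrec.fst.comp Primrec.unpair) (Primrec.snd.comp Primrec.unpair)
  simpa [TotalFunctional] using TotalFunctional.map h1 (hf.pair hg)

theorem TotalFunctional.query {f : Baire → ℕ → ℕ} (hf : TotalFunctional f) :
    TotalFunctional fun p n => p (f p n) :=
  TotalFunctional.at (f := fun p n => p n) PartrecFunctional.oracle hf

theorem TotalFunctional.ident : TotalFunctional fun _ n => n := .of_primrec Primrec.id

theorem TotalFunctional.const (c : ℕ) : TotalFunctional fun _ _ => c :=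
  .of_primrec (Primrec.const c)

theorem PartrecFunctional.map₂ {h : ℕ → ℕ → ℕ} {f g : Baire → ℕ →. ℕ} (hh : Primrec₂ h)
    (hf : PartrecFunctional f) (hg : PartrecFunctional g) :
    PartrecFunctional fun p n => (f p n).bind fun a => (g p n).bind fun b =>
      Part.some (h a b) := by
  have h1 : Primrec fun m : ℕ => h m.unpair.1 m.unpair.2 :=
    hh.comp (Primrec.fst.comp Primrec.unpair) (Primrec.snd.comp Primrec.unpair)
  refine (PartrecFunctional.comp (TotalFunctional.of_primrec h1) (hf.pair hg)).of_eq fun p n => ?_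
  simp [Part.bind_assoc]

theorem TotalFunctional.ite {c f g : Baire → ℕ → ℕ} (hc : TotalFunctional c)
    (hf : TotalFunctional f) (hg : TotalFunctional g) :
    TotalFunctional fun p n => if c p n = 0 then f p n else g p n := by
  have h1 : Primrec fun m : ℕ =>
      if m.unpair.1 = 0 then m.unpair.2.unpair.1 else m.unpair.2.unpair.2 := by
    have hs : Primrec fun m : ℕ => m.unpair.2 := Primrec.snd.comp Primrec.unpair
    exact Primrec.ite (Primrec.eq.comp (Primrec.fst.comp Primrec.unpair) (Primrec.const 0))
      (Primrec.fst.comp (Primrec.unpair.comp hs)) (Primrec.snd.comp (Primrec.unpair.comp hs))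
  simpa [TotalFunctional] using TotalFunctional.map h1 (hc.pair (hf.pair hg))

/-- Evaluation of `f` guarded by a decidable condition. -/
theorem PartrecFunctional.guard {c : Baire → ℕ → ℕ} {f : Baire → ℕ →. ℕ}
    (hc : TotalFunctional c) (hf : PartrecFunctional f) :
    PartrecFunctional fun p n => if c p n = 0 then Part.some 0 else f p n := by
  have h1 : PartrecFunctional fun p m => f p m.unpair.1 := hf.at (g := fun _ m => m.unpair.1) .left
  have h2 := (PartrecFunctional.prec .zero h1).at (TotalFunctional.pair .ident
    (TotalFunctional.ite hc (.const 0) (.const 1)))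
  refine h2.of_eq fun p n => ?_
  by_cases h : c p n = 0 <;> simp [h]

theorem PartrecFunctional.cond {c : Baire → ℕ → ℕ} {f g : Baire → ℕ →. ℕ}
    (hc : TotalFunctional c) (hf : PartrecFunctional f) (hg : PartrecFunctional g) :
    PartrecFunctional fun p n => if c p n = 0 then f p n else g p n := by
  have hc' : TotalFunctional fun p n => if c p n = 0 then 1 else 0 := hc.ite (.const 1) (.const 0)
  refine (PartrecFunctional.map₂ Primrec.nat_add (hf.guard hc') (hg.guard hc)).of_eq fun p n => ?_
  by_cases h : c p n = 0 <;> simp [h]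

/-- Substitution of a computable family of oracles. -/
theorem PartrecFunctional.subst {Ψ Θ : Baire → ℕ →. ℕ} (hΨ : PartrecFunctional Ψ)
    (hΘ : PartrecFunctional Θ) : ∃ Ξ, PartrecFunctional Ξ ∧ ∀ (p : Baire) (i : ℕ) (o : Baire),
      (∀ k, Θ p (Nat.pair i k) = Part.some (o k)) → ∀ n, Ξ p (Nat.pair i n) = Ψ o n := by
  have hL : TotalFunctional fun _ m => m.unpair.1 := .left
  have hR : TotalFunctional fun _ m => m.unpair.2 := .right
  induction hΨ with
  | zero => exact ⟨_, .zero, fun _ _ _ _ _ => rfl⟩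
  | succ => exact ⟨_, PartrecFunctional.succ.at hR, fun _ _ _ _ _ => by simp⟩
  | left => exact ⟨_, PartrecFunctional.left.at hR, fun _ _ _ _ _ => by simp⟩
  | right => exact ⟨_, PartrecFunctional.right.at hR, fun _ _ _ _ _ => by simp⟩
  | oracle => exact ⟨Θ, hΘ, fun _ _ _ h n => h n⟩
  | pair _ _ h1 h2 =>
    obtain ⟨F, hF, eF⟩ := h1
    obtain ⟨G, hG, eG⟩ := h2
    exact ⟨_, hF.pair hG, fun p i o h n => by simp only [eF p i o h, eG p i o h]⟩
  | comp _ _ h1 h2 =>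
    obtain ⟨F, hF, eF⟩ := h1
    obtain ⟨G, hG, eG⟩ := h2
    refine ⟨_, hF.comp (PartrecFunctional.pair hL hG), fun p i o h n => ?_⟩
    simp [Part.bind_assoc, eF p i o h, eG p i o h]
  | prec _ _ h1 h2 =>
    obtain ⟨F, hF, eF⟩ := h1
    obtain ⟨G, hG, eG⟩ := h2
    have hLL := hL.at hL
    have hRL := hR.at hL
    refine ⟨_, (PartrecFunctional.prec hF (hG.at (hLL.pair (hRL.pair hR)))).at
      ((hL.pair (hL.at hR)).pair (hR.at hR)), fun p i o h n => ?_⟩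
    simp only [Nat.unpair_pair, eF p i o h, eG p i o h]
  | rfind _ h1 =>
    obtain ⟨F, hF, eF⟩ := h1
    have hLL := hL.at hL
    have hRL := hR.at hL
    refine ⟨_, PartrecFunctional.rfind (hF.at (hLL.pair (hRL.pair hR))), fun p i o h n => ?_⟩
    simp only [Nat.unpair_pair, eF p i o h]

/-! ## Combining functionals with infinite output -/

theorem Outputs.of_total {F : Baire → Baire} (p : Baire) :
    Outputs (fun p n => Part.some (F p n)) p (F p) := fun _ => rfl

theorem exists_outputs_comp {Ψ Θ : Baire → ℕ →. ℕ} (hΨ : PartrecFunctional Ψ)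
    (hΘ : PartrecFunctional Θ) : ∃ Ξ, PartrecFunctional Ξ ∧
      ∀ x y z, Outputs Θ x y → Outputs Ψ y z → Outputs Ξ x z := by
  obtain ⟨Ξ, hΞ, e⟩ := hΨ.subst (hΘ.at (g := fun _ m => m.unpair.2) .right)
  refine ⟨_, hΞ.at ((TotalFunctional.const 0).pair .ident), fun x y z h1 h2 n => ?_⟩
  rw [e x 0 y (fun k => by simpa using h1 k) n, h2 n]

theorem exists_outputs_pair {Ψ Θ : Baire → ℕ →. ℕ} (hΨ : PartrecFunctional Ψ)
    (hΘ : PartrecFunctional Θ) : ∃ Ξ, PartrecFunctional Ξ ∧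
      ∀ x y z, Outputs Ψ x y → Outputs Θ x z → Outputs Ξ x (pair y z) := by
  have hd : TotalFunctional fun _ n => n / 2 :=
    .of_primrec (Primrec.nat_div.comp Primrec.id (Primrec.const 2))
  have hm : TotalFunctional fun _ n => n % 2 :=
    .of_primrec (Primrec.nat_mod.comp Primrec.id (Primrec.const 2))
  refine ⟨_, PartrecFunctional.cond hm (hΨ.at hd) (hΘ.at hd), fun x y z h1 h2 n => ?_⟩
  by_cases h : n % 2 = 0 <;> simp [h, pair, h1 _, h2 _]

theorem exists_outputs_hat {Ψ : Baire → ℕ →. ℕ} (hΨ : PartrecFunctional Ψ) :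
    ∃ Ξ, PartrecFunctional Ξ ∧ ∀ (x : Baire) (y : ℕ → Baire),
      (∀ i, Outputs Ψ (proj i x) (y i)) → Outputs Ξ x (tuple y) := by
  obtain ⟨Ξ, hΞ, e⟩ := hΨ.subst .oracle
  refine ⟨Ξ, hΞ, fun x y h n => ?_⟩
  have := e x n.unpair.1 (proj n.unpair.1 x) (fun _ => rfl) n.unpair.2
  rw [Nat.pair_unpair] at this
  rw [this, h _ _, tuple]

/-- `finTuple` preceded by its length, with the convention `0^ℕ` at length `0`. -/
def starTuple (n : ℕ) (y : ℕ → Baire) : Baire :=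
  if n = 0 then fun _ => 0 else cons n (finTuple n y)

theorem exists_outputs_star {Ψ : Baire → ℕ →. ℕ} (hΨ : PartrecFunctional Ψ) :
    ∃ Ξ, PartrecFunctional Ξ ∧ ∀ (x : Baire) (y : ℕ → Baire),
      (∀ i < x 0, Outputs Ψ (finProj (x 0) i (tail x)) (y i)) →
        Outputs Ξ x (starTuple (x 0) y) := by
  have hL : TotalFunctional fun _ m => m.unpair.1 := .left
  have hR : TotalFunctional fun _ m => m.unpair.2 := .right
  have h0 : TotalFunctional fun x _ => x 0 := TotalFunctional.query (.const 0)
  obtain ⟨Ξ, hΞ, e⟩ := hΨ.subst (Θ := fun x m =>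
    Part.some (x (x 0 * m.unpair.2 + m.unpair.1 + 1)))
    ((TotalFunctional.map₂ Primrec.nat_add (.map₂ Primrec.nat_add
      (.map₂ Primrec.nat_mul h0 hR) hL) (.const 1)).query)
  have hp : TotalFunctional fun _ m => m - 1 := .of_primrec Primrec.pred
  refine ⟨_, PartrecFunctional.cond .ident h0 (PartrecFunctional.guard h0
    (hΞ.at ((TotalFunctional.map₂ Primrec.nat_mod hp h0).pair
      (TotalFunctional.map₂ Primrec.nat_div hp h0)))), fun x y h n => ?_⟩
  by_cases hx : x 0 = 0
  · cases n <;> simp [starTuple, hx]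
  · cases n with
    | zero => simp [starTuple, hx, cons]
    | succ m =>
      have hlt : m % x 0 < x 0 := Nat.mod_lt _ (Nat.pos_of_ne_zero hx)
      have := e x (m % x 0) (finProj (x 0) (m % x 0) (tail x))
        (fun k => by simp [finProj, tail]) (m / x 0)
      simp [starTuple, hx, cons, this, h _ hlt _, finTuple]

/-! ## Tupling identities -/

@[simp] theorem fst_pair (p q : Baire) : fst (pair p q) = p := by
  funext k; simp [fst, pair]

@[simp] theorem snd_pair (p q : Baire) : snd (pair p q) = q := by
  funext k
  have h1 : (2 * k + 1) % 2 = 1 := by omega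
  have h2 : (2 * k + 1) / 2 = k := by omega
  simp [snd, pair, h1, h2]

@[simp] theorem pair_fst_snd (x : Baire) : pair (fst x) (snd x) = x := by
  funext k
  by_cases h : k % 2 = 0
  · have : 2 * (k / 2) = k := by omega
    simp [pair, fst, h, this]
  · have : 2 * (k / 2) + 1 = k := by omega
    simp [pair, snd, h, this]

@[simp] theorem tail_cons (n : ℕ) (p : Baire) : tail (cons n p) = p := rfl

@[simp] theorem cons_zero (n : ℕ) (p : Baire) : cons n p 0 = n := rfl

@[simp] theorem proj_tuple (i : ℕ) (y : ℕ → Baire) : proj i (tuple y) = y i := by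
  funext k; simp [proj, tuple]

theorem finProj_finTuple {n i : ℕ} (h : i < n) (y : ℕ → Baire) :
    finProj n i (finTuple n y) = y i := by
  funext k
  have h1 : (n * k + i) % n = i := by rw [Nat.mul_add_mod, Nat.mod_eq_of_lt h]
  have h2 : (n * k + i) / n = k := by
    rw [Nat.mul_add_div (by omega), Nat.div_eq_of_lt h, add_zero]
  simp [finProj, finTuple, h1, h2]

@[simp] theorem starTuple_zero (n : ℕ) (y : ℕ → Baire) : starTuple n y 0 = n := by
  by_cases h : n = 0 <;> simp [starTuple, h]

theorem finProj_tail_starTuple {n i : ℕ} (h : i < n) (y : ℕ → Baire) :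
    finProj n i (tail (starTuple n y)) = y i := by
  rw [starTuple, if_neg (by omega), tail_cons, finProj_finTuple h]

theorem total_fst : TotalFunctional fst :=
  (TotalFunctional.of_primrec (Primrec.nat_mul.comp (Primrec.const 2) Primrec.id)).query

theorem total_snd : TotalFunctional snd :=
  (TotalFunctional.of_primrec (Primrec.succ.comp
    (Primrec.nat_mul.comp (Primrec.const 2) Primrec.id))).query

theorem total_tail : TotalFunctional tail :=
  (TotalFunctional.of_primrec Primrec.succ).query

theorem TotalFunctional.comp {F G : Baire → Baire} (hF : TotalFunctional F)
    (hG : TotalFunctional G) : TotalFunctional fun x => F (G x) := by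
  obtain ⟨Ξ, hΞ, e⟩ := exists_outputs_comp hF hG
  exact hΞ.of_eq fun x n => e x _ _ (Outputs.of_total x) (Outputs.of_total (G x)) n

theorem TotalFunctional.pairing {F G : Baire → Baire} (hF : TotalFunctional F)
    (hG : TotalFunctional G) : TotalFunctional fun x => Weihrauch.pair (F x) (G x) := by
  obtain ⟨Ξ, hΞ, e⟩ := exists_outputs_pair hF hG
  exact hΞ.of_eq fun x n => e x _ _ (Outputs.of_total x) (Outputs.of_total x) n

theorem TotalFunctional.consing {F : Baire → Baire} (c : ℕ) (hF : TotalFunctional F) :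
    TotalFunctional fun x => cons c (F x) := by
  refine (TotalFunctional.ite .ident (.const c)
    (hF.at (.of_primrec Primrec.pred))).of_eq fun p n => ?_
  cases n <;> simp [cons]

/-! ## The preorder of Weihrauch reducibility and monotonicity of the operations -/

namespace Problem

/-- A reduction given by two functionals. -/
theorem reducible_iff {P Q : Problem} : Reducible P Q ↔
    ∃ Ψ Θ, PartrecFunctional Ψ ∧ PartrecFunctional Θ ∧ ∀ x ∈ P.dom, ∃ k ∈ Q.dom,
      Outputs Θ x k ∧ ∀ y ∈ Q k, ∃ z ∈ P x, Outputs Ψ (pair x y) z := by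
  classical
  constructor
  · rintro ⟨H, K, ⟨Ψ, hΨ, eΨ⟩, ⟨Θ, hΘ, eΘ⟩, h⟩
    refine ⟨Ψ, Θ, hΨ, hΘ, fun x hx => ?_⟩
    -- a choice function with domain `dom Q` and a prescribed value
    have key : ∀ k₀ y₀, y₀ ∈ Q k₀ → ∃ k ∈ Q.dom, k ∈ K x ∧
        (k = k₀ → ∃ z ∈ P x, z ∈ H (pair x y₀)) := by
      intro k₀ y₀ hy₀
      let g : Baire →. Baire := fun k =>
        ⟨k ∈ Q.dom, fun hk => if k = k₀ then y₀ else hk.some⟩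
      have hg : IsChoice g Q := by
        intro k hk
        refine ⟨_, ⟨hk, rfl⟩, ?_⟩
        by_cases e : k = k₀
        · subst e; simpa [g] using hy₀
        · simpa [g, e] using hk.some_mem
      obtain ⟨z, hz, hzP⟩ := h g hg x hx
      simp only [Part.mem_bind_iff] at hz
      obtain ⟨k, hk, y, ⟨hkd, hy⟩, hz⟩ := hz
      refine ⟨k, hkd, hk, ?_⟩
      rintro rfl
      simp only [g, if_true] at hy
      subst hy
      exact ⟨z, hzP, hz⟩
    have ex : ∃ k ∈ Q.dom, k ∈ K x := by
      let g : Baire →. Baire := fun k => ⟨k ∈ Q.dom, fun hk => hk.some⟩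
      have hg : IsChoice g Q := fun k hk => ⟨_, ⟨hk, rfl⟩, hk.some_mem⟩
      obtain ⟨z, hz, hzP⟩ := h g hg x hx
      simp only [Part.mem_bind_iff] at hz
      obtain ⟨k, hk, y, ⟨hkd, hy⟩, hz⟩ := hz
      exact ⟨k, hkd, hk⟩
    obtain ⟨k, hkd, hk⟩ := ex
    refine ⟨k, hkd, eΘ x k hk, fun y hy => ?_⟩
    obtain ⟨k', _, hk', hz⟩ := key k y hy
    obtain ⟨z, hzP, hz⟩ := hz (Part.mem_unique hk' hk)
    exact ⟨z, hzP, eΨ _ z hz⟩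
  · rintro ⟨Ψ, Θ, hΨ, hΘ, h⟩
    have out : ∀ Ψ : Baire → ℕ →. ℕ, ∃ F : Baire →. Baire,
        ∀ p q, q ∈ F p ↔ Outputs Ψ p q := by
      intro Ψ
      refine ⟨fun p => ⟨∃ q, Outputs Ψ p q, fun hq => hq.choose⟩, fun p q => ?_⟩
      constructor
      · rintro ⟨hq, rfl⟩; exact hq.choose_spec
      · intro hq
        have hq' : ∃ q, Outputs Ψ p q := ⟨q, hq⟩
        refine ⟨hq', funext fun n => ?_⟩
        exact Part.some_inj.1 ((hq'.choose_spec n).symm.trans (hq n))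
    obtain ⟨H, hH⟩ := out Ψ
    obtain ⟨K, hK⟩ := out Θ
    refine ⟨H, K, ⟨Ψ, hΨ, fun p q => (hH p q).1⟩, ⟨Θ, hΘ, fun p q => (hK p q).1⟩, ?_⟩
    intro g hg x hx
    obtain ⟨k, hk, hΘk, h2⟩ := h x hx
    obtain ⟨y, hy, hyQ⟩ := hg k hk
    obtain ⟨z, hz, hΨz⟩ := h2 y hyQ
    refine ⟨z, ?_, hz⟩
    simp only [Part.mem_bind_iff]
    exact ⟨k, (hK _ _).2 hΘk, y, hy, (hH _ _).2 hΨz⟩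

/-- A reduction by total functions. -/
theorem Reducible.of_total {P Q : Problem} {F G : Baire → Baire} (hF : TotalFunctional F)
    (hG : TotalFunctional G) (h : ∀ x ∈ P.dom, G x ∈ Q.dom ∧ ∀ y ∈ Q (G x), F (pair x y) ∈ P x) :
    Reducible P Q :=
  reducible_iff.2 ⟨_, _, hF, hG, fun x hx => ⟨G x, (h x hx).1, Outputs.of_total x,
    fun y hy => ⟨_, (h x hx).2 y hy, Outputs.of_total _⟩⟩⟩

theorem total_id : TotalFunctional fun x : Baire => x := PartrecFunctional.oracle

theorem Reducible.refl (P : Problem) : Reducible P P :=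
  .of_total total_snd total_id fun x hx => ⟨hx, fun y hy => by simpa using hy⟩

theorem Reducible.trans {P Q R : Problem} (h1 : Reducible P Q) (h2 : Reducible Q R) :
    Reducible P R := by
  obtain ⟨H1, K1, hH1, hK1, h1⟩ := reducible_iff.1 h1
  obtain ⟨H2, K2, hH2, hK2, h2⟩ := reducible_iff.1 h2
  obtain ⟨K, hK, eK⟩ := exists_outputs_comp hK2 hK1
  -- `⟨x, y⟩ ↦ K1 x`
  obtain ⟨A, hA, eA⟩ := exists_outputs_comp hK1 total_fst
  obtain ⟨B, hB, eB⟩ := exists_outputs_pair hA total_snd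
  obtain ⟨C, hC, eC⟩ := exists_outputs_comp hH2 hB
  obtain ⟨D, hD, eD⟩ := exists_outputs_pair total_fst hC
  obtain ⟨E, hE, eE⟩ := exists_outputs_comp hH1 hD
  refine reducible_iff.2 ⟨E, K, hE, hK, fun x hx => ?_⟩
  obtain ⟨k, hk, hxk, h1⟩ := h1 x hx
  obtain ⟨l, hl, hkl, h2⟩ := h2 k hk
  refine ⟨l, hl, eK _ _ _ hxk hkl, fun y hy => ?_⟩
  obtain ⟨z, hz, hz'⟩ := h2 y hy
  obtain ⟨w, hw, hw'⟩ := h1 z hz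
  have u1 : Outputs A (pair x y) k := eA _ _ _ (Outputs.of_total _) (by simpa using hxk)
  have u2 : Outputs C (pair x y) z :=
    eC _ _ _ (eB _ _ _ u1 (Outputs.of_total _)) (by simpa using hz')
  exact ⟨w, hw, eE _ _ _ (eD _ _ _ (Outputs.of_total _) u2) (by simpa using hw')⟩

instance : Preorder Problem where
  le := Reducible
  le_refl := Reducible.refl
  le_trans _ _ _ := Reducible.trans

theorem mem_dom_times {P Q : Problem} {x : Baire} :
    x ∈ (times P Q).dom ↔ fst x ∈ P.dom ∧ snd x ∈ Q.dom := by
  constructor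
  · rintro ⟨y, h1, h2⟩; exact ⟨⟨_, h1⟩, ⟨_, h2⟩⟩
  · rintro ⟨⟨y, h1⟩, ⟨z, h2⟩⟩; exact ⟨pair y z, by simpa using h1, by simpa using h2⟩

theorem mem_dom_hat {P : Problem} {x : Baire} : x ∈ (hat P).dom ↔ ∀ i, proj i x ∈ P.dom := by
  constructor
  · rintro ⟨y, h⟩ i; exact ⟨_, h i⟩
  · intro h; exact ⟨tuple fun i => (h i).some, fun i => by simpa using (h i).some_mem⟩

theorem starTuple_mem_star {P : Problem} {x : Baire} {y : ℕ → Baire}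
    (h : ∀ i < x 0, y i ∈ P (finProj (x 0) i (tail x))) : starTuple (x 0) y ∈ star P x := by
  by_cases hx : x 0 = 0
  · exact Or.inl ⟨hx, by simp [starTuple, hx]⟩
  · exact Or.inr ⟨hx, by simp, fun i hi => by
      rw [finProj_tail_starTuple hi]; exact h i hi⟩

theorem star_apply {P : Problem} {x y : Baire} (h : y ∈ star P x) :
    y 0 = x 0 ∧ ∀ i < x 0, finProj (x 0) i (tail y) ∈ P (finProj (x 0) i (tail x)) := by
  rcases h with ⟨h, rfl⟩ | ⟨_, h⟩
  · exact ⟨h.symm, fun i hi => by omega⟩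
  · exact h

theorem mem_dom_star {P : Problem} {x : Baire} :
    x ∈ (star P).dom ↔ ∀ i < x 0, finProj (x 0) i (tail x) ∈ P.dom := by
  classical
  constructor
  · rintro ⟨y, h⟩ i hi; exact ⟨_, (star_apply h).2 i hi⟩
  · intro h
    refine ⟨_, starTuple_mem_star (y := fun i => if hi : i < x 0 then (h i hi).some else 0) ?_⟩
    intro i hi
    simpa [hi] using (h i hi).some_mem

theorem mem_dom_oplus {P Q : Problem} {x : Baire} :
    x ∈ (oplus P Q).dom ↔ fst x ∈ P.dom ∧ snd x ∈ Q.dom := by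
  constructor
  · rintro ⟨y, h1, h2, _⟩; exact ⟨h1, h2⟩
  · rintro ⟨h1, h2⟩; exact ⟨_, h1, h2, Or.inl ⟨_, h1.some_mem, rfl⟩⟩

theorem times_mono {P P' Q Q' : Problem} (h1 : P ≤ P') (h2 : Q ≤ Q') :
    times P Q ≤ times P' Q' := by
  obtain ⟨H1, K1, hH1, hK1, h1⟩ := reducible_iff.1 h1
  obtain ⟨H2, K2, hH2, hK2, h2⟩ := reducible_iff.1 h2
  obtain ⟨A1, hA1, eA1⟩ := exists_outputs_comp hK1 total_fst
  obtain ⟨A2, hA2, eA2⟩ := exists_outputs_comp hK2 total_snd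
  obtain ⟨A, hA, eA⟩ := exists_outputs_pair hA1 hA2
  obtain ⟨B1, hB1, eB1⟩ := exists_outputs_comp hH1
    ((total_fst.comp total_fst).pairing (total_fst.comp total_snd))
  obtain ⟨B2, hB2, eB2⟩ := exists_outputs_comp hH2
    ((total_snd.comp total_fst).pairing (total_snd.comp total_snd))
  obtain ⟨B, hB, eB⟩ := exists_outputs_pair hB1 hB2
  refine reducible_iff.2 ⟨B, A, hB, hA, fun x hx => ?_⟩
  obtain ⟨hx1, hx2⟩ := mem_dom_times.1 hx
  obtain ⟨k1, hk1, o1, h1⟩ := h1 _ hx1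
  obtain ⟨k2, hk2, o2, h2⟩ := h2 _ hx2
  refine ⟨pair k1 k2, mem_dom_times.2 (by simpa using ⟨hk1, hk2⟩), eA _ _ _
    (eA1 _ _ _ (Outputs.of_total _) o1) (eA2 _ _ _ (Outputs.of_total _) o2), ?_⟩
  rintro y ⟨hy1, hy2⟩
  simp only [fst_pair, snd_pair] at hy1 hy2
  obtain ⟨z1, hz1, u1⟩ := h1 _ hy1
  obtain ⟨z2, hz2, u2⟩ := h2 _ hy2
  refine ⟨pair z1 z2, ⟨by simpa using hz1, by simpa using hz2⟩, eB _ _ _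
    (eB1 _ _ _ (Outputs.of_total _) (by simpa using u1))
    (eB2 _ _ _ (Outputs.of_total _) (by simpa using u2))⟩

theorem oplus_le_left (P Q : Problem) : oplus P Q ≤ P :=
  Reducible.of_total (total_snd.consing 0) total_fst fun x hx => by
    obtain ⟨h1, h2⟩ := mem_dom_oplus.1 hx
    exact ⟨h1, fun y hy => ⟨h1, h2, Or.inl ⟨y, hy, by simp⟩⟩⟩

theorem oplus_le_right (P Q : Problem) : oplus P Q ≤ Q :=
  Reducible.of_total (total_snd.consing 1) total_snd fun x hx => by
    obtain ⟨h1, h2⟩ := mem_dom_oplus.1 hx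
    exact ⟨h2, fun y hy => ⟨h1, h2, Or.inr ⟨y, hy, by simp⟩⟩⟩

theorem le_oplus {P Q R : Problem} (h1 : R ≤ P) (h2 : R ≤ Q) : R ≤ oplus P Q := by
  obtain ⟨H1, K1, hH1, hK1, h1⟩ := reducible_iff.1 h1
  obtain ⟨H2, K2, hH2, hK2, h2⟩ := reducible_iff.1 h2
  obtain ⟨K, hK, eK⟩ := exists_outputs_pair hK1 hK2
  have hT := total_fst.pairing (total_tail.comp total_snd)
  obtain ⟨B1, hB1, eB1⟩ := exists_outputs_comp hH1 hT
  obtain ⟨B2, hB2, eB2⟩ := exists_outputs_comp hH2 hT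
  have hc : TotalFunctional fun w _ => snd w 0 := TotalFunctional.at total_snd (.const 0)
  refine reducible_iff.2 ⟨_, K, PartrecFunctional.cond hc hB1 hB2, hK, fun x hx => ?_⟩
  obtain ⟨k1, hk1, o1, h1⟩ := h1 _ hx
  obtain ⟨k2, hk2, o2, h2⟩ := h2 _ hx
  refine ⟨pair k1 k2, mem_dom_oplus.2 (by simpa using ⟨hk1, hk2⟩), eK _ _ _ o1 o2, ?_⟩
  rintro y ⟨-, -, ⟨w, hw, rfl⟩ | ⟨w, hw, rfl⟩⟩
  · obtain ⟨z, hz, u⟩ := h1 w (by simpa using hw)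
    exact ⟨z, hz, fun n => by
      simpa using eB1 _ _ _ (Outputs.of_total _) (by simpa using u) n⟩
  · obtain ⟨z, hz, u⟩ := h2 w (by simpa using hw)
    exact ⟨z, hz, fun n => by
      simpa using eB2 _ _ _ (Outputs.of_total _) (by simpa using u) n⟩

theorem hat_mono {P Q : Problem} (h : P ≤ Q) : hat P ≤ hat Q := by
  obtain ⟨H, K, hH, hK, h⟩ := reducible_iff.1 h
  obtain ⟨A, hA, eA⟩ := exists_outputs_hat hK
  obtain ⟨B, hB, eB⟩ := exists_outputs_hat hH
  -- `⟨x, y⟩ ↦ ⟨⟨x₀, y₀⟩, ⟨x₁, y₁⟩, …⟩`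
  have hT : TotalFunctional fun w => tuple fun i => pair (proj i (fst w)) (proj i (snd w)) := by
    have hL : TotalFunctional fun _ m => m.unpair.1 := .left
    have hR : TotalFunctional fun _ m => m.unpair.2 := .right
    have hk : TotalFunctional fun _ m => Nat.pair m.unpair.1 (m.unpair.2 / 2) :=
      hL.pair (.map₂ Primrec.nat_div hR (.const 2))
    exact TotalFunctional.ite (.map₂ Primrec.nat_mod hR (.const 2))
      (total_fst.at hk) (total_snd.at hk)
  obtain ⟨C, hC, eC⟩ := exists_outputs_comp hB hT
  refine reducible_iff.2 ⟨C, A, hC, hA, fun x hx => ?_⟩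
  choose k hk o h using fun i => h _ (mem_dom_hat.1 hx i)
  refine ⟨tuple k, mem_dom_hat.2 (by simpa using hk), eA _ _ o, fun y hy => ?_⟩
  choose z hz u using fun i => h i (proj i y) (by simpa using hy i)
  exact ⟨tuple z, fun i => by simpa using hz i,
    eC _ _ _ (Outputs.of_total _) (eB _ _ fun i => by simpa using u i)⟩

theorem le_hat (P : Problem) : P ≤ hat P := by
  have hR : TotalFunctional fun _ m => m.unpair.2 := .right
  refine Reducible.of_total (F := fun w => proj 0 (snd w)) (G := fun x => tuple fun _ => x)
    (total_snd.at ((TotalFunctional.const 0).pair .ident)) hR.query fun x hx => ?_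
  exact ⟨mem_dom_hat.2 (by simpa using hx), fun y hy => by simpa using hy 0⟩

theorem times_self_le_hat (P : Problem) : times P P ≤ hat P := by
  have hL : TotalFunctional fun _ m => m.unpair.1 := .left
  have hR : TotalFunctional fun _ m => m.unpair.2 := .right
  refine Reducible.of_total (F := fun w => pair (proj 0 (snd w)) (proj 1 (snd w)))
    (G := fun x => tuple fun i => if i = 0 then fst x else snd x)
    (TotalFunctional.pairing (total_snd.at ((TotalFunctional.const 0).pair .ident))
      (total_snd.at ((TotalFunctional.const 1).pair .ident))) ?_ fun x hx => ?_
  · refine (TotalFunctional.ite hL (total_fst.at hR) (total_snd.at hR)).of_eq fun p n => ?_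
    by_cases h : n.unpair.1 = 0 <;> simp [tuple, h]
  · obtain ⟨h1, h2⟩ := mem_dom_times.1 hx
    refine ⟨mem_dom_hat.2 fun i => ?_, fun y hy => ⟨?_, ?_⟩⟩
    · by_cases h : i = 0 <;> simpa [h]
    · simpa using hy 0
    · simpa using hy 1

theorem hat_times_le (P Q : Problem) : hat (times P Q) ≤ times (hat P) (hat Q) := by
  have hL : TotalFunctional fun _ m => m.unpair.1 := .left
  have hR : TotalFunctional fun _ m => m.unpair.2 := .right
  have hk : TotalFunctional fun _ m => Nat.pair m.unpair.1 (m.unpair.2 / 2) :=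
    hL.pair (.map₂ Primrec.nat_div hR (.const 2))
  have hT : TotalFunctional fun w => tuple fun i => pair (proj i (fst w)) (proj i (snd w)) :=
    TotalFunctional.ite (.map₂ Primrec.nat_mod hR (.const 2)) (total_fst.at hk) (total_snd.at hk)
  have h2 : TotalFunctional fun _ m => 2 * m.unpair.2 := .map₂ Primrec.nat_mul (.const 2) hR
  have hG1 : TotalFunctional fun x => tuple fun i => fst (proj i x) := (hL.pair h2).query
  have hG2 : TotalFunctional fun x => tuple fun i => snd (proj i x) :=
    (hL.pair (.map Primrec.succ h2)).query
  refine Reducible.of_total (hT.comp total_snd) (hG1.pairing hG2) fun x hx => ?_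
  have hx' := fun i => mem_dom_times.1 (mem_dom_hat.1 hx i)
  refine ⟨mem_dom_times.2 ⟨mem_dom_hat.2 fun i => ?_, mem_dom_hat.2 fun i => ?_⟩, ?_⟩
  · simpa using (hx' i).1
  · simpa using (hx' i).2
  · rintro y ⟨hy1, hy2⟩ i
    exact ⟨by simpa using hy1 i, by simpa using hy2 i⟩

theorem total_head : TotalFunctional fun w _ => w 0 := TotalFunctional.query (.const 0)

/-- Rearrangement of the components of an element of `dom P*`. -/
theorem total_starTuple {c : Baire → ℕ → ℕ} {f : Baire → ℕ → ℕ} (hc : TotalFunctional c)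
    (hf : TotalFunctional f) :
    TotalFunctional fun w => starTuple (c w 0)
      fun i k => f w (Nat.pair i k) := by
  have hc : TotalFunctional fun w _ => c w 0 := hc.at (.const 0)
  have hp : TotalFunctional fun _ m => m - 1 := .of_primrec Primrec.pred
  refine (TotalFunctional.ite .ident hc (TotalFunctional.ite hc (.const 0)
    (hf.at ((TotalFunctional.map₂ Primrec.nat_mod hp hc).pair
      (TotalFunctional.map₂ Primrec.nat_div hp hc))))).of_eq fun w n => ?_
  by_cases hw : c w 0 = 0
  · cases n <;> simp [starTuple, hw]
  · cases n <;> simp [starTuple, hw, cons, finTuple]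

/-- The index map of `finProj n i (tail ·)`, for `m = ⟨i, k⟩`. -/
theorem total_finIndex {c g : Baire → ℕ → ℕ} (hc : TotalFunctional c) (hg : TotalFunctional g) :
    TotalFunctional fun w m => c w m * g w m + m.unpair.1 + 1 := by
  have h1 : TotalFunctional fun w m => c w m * g w m := .map₂ Primrec.nat_mul hc hg
  have h2 : TotalFunctional fun _ m => m.unpair.1 := .left
  have h3 : TotalFunctional fun w m => c w m * g w m + m.unpair.1 := .map₂ Primrec.nat_add h1 h2
  exact .map Primrec.succ h3

theorem star_mono {P Q : Problem} (h : P ≤ Q) : star P ≤ star Q := by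
  obtain ⟨H, K, hH, hK, h⟩ := reducible_iff.1 h
  obtain ⟨A, hA, eA⟩ := exists_outputs_star hK
  obtain ⟨B, hB, eB⟩ := exists_outputs_star hH
  have hR : TotalFunctional fun _ m => m.unpair.2 := .right
  have hn : TotalFunctional fun w _ => fst w 0 := TotalFunctional.at total_fst (.const 0)
  have hk : TotalFunctional fun w m => fst w 0 * (m.unpair.2 / 2) + m.unpair.1 + 1 :=
    total_finIndex hn (.map₂ Primrec.nat_div hR (.const 2))
  have hT := total_starTuple hn (TotalFunctional.ite (.map₂ Primrec.nat_mod hR (.const 2))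
      (total_fst.at hk) (total_snd.at hk))
  obtain ⟨C, hC, eC⟩ := exists_outputs_comp hB hT
  refine reducible_iff.2 ⟨C, A, hC, hA, fun x hx => ?_⟩
  have hx' := mem_dom_star.1 hx
  have ex : ∀ i, ∃ k, i < x 0 → k ∈ Q.dom ∧ Outputs K (finProj (x 0) i (tail x)) k ∧
      ∀ y ∈ Q k, ∃ z ∈ P (finProj (x 0) i (tail x)),
        Outputs H (pair (finProj (x 0) i (tail x)) y) z := fun i => by
    by_cases hi : i < x 0
    · obtain ⟨k, h1, h2⟩ := h _ (hx' i hi)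
      exact ⟨k, fun _ => ⟨h1, h2⟩⟩
    · exact ⟨0, fun h => absurd h hi⟩
  choose k hk using ex
  refine ⟨starTuple (x 0) k, mem_dom_star.2 fun i hi => ?_,
    eA _ _ fun i hi => (hk i hi).2.1, fun y hy => ?_⟩
  · rw [starTuple_zero] at hi ⊢
    rw [finProj_tail_starTuple hi]
    exact (hk i hi).1
  · obtain ⟨hy0, hy⟩ := star_apply hy
    rw [starTuple_zero] at hy0 hy
    have ez : ∀ i, ∃ z, i < x 0 → z ∈ P (finProj (x 0) i (tail x)) ∧
        Outputs H (pair (finProj (x 0) i (tail x)) (finProj (x 0) i (tail y))) z := fun i => by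
      by_cases hi : i < x 0
      · have := hy i hi
        rw [finProj_tail_starTuple hi] at this
        obtain ⟨z, h1, h2⟩ := (hk i hi).2.2 _ this
        exact ⟨z, fun _ => ⟨h1, h2⟩⟩
      · exact ⟨0, fun h => absurd h hi⟩
    choose z hz using ez
    refine ⟨starTuple (x 0) z, starTuple_mem_star fun i hi => (hz i hi).1,
      eC _ _ _ (Outputs.of_total _) ?_⟩
    have := eB (starTuple (x 0) fun i => pair (finProj (x 0) i (tail x))
      (finProj (x 0) i (tail y))) z
    simp only [starTuple_zero] at this
    convert this fun i hi => ?_ using 1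
    · simp only [fst_pair, snd_pair]
      congr 1
      funext i k
      simp [pair, finProj, tail]
    · rw [finProj_tail_starTuple hi]
      exact (hz i hi).2

theorem le_star (P : Problem) : P ≤ star P := by
  refine Reducible.of_total (F := fun w => tail (snd w)) (G := fun x => cons 1 x)
    (total_tail.comp total_snd) (total_id.consing 1) fun x hx => ?_
  have e : ∀ w, finProj 1 0 w = w := fun w => by funext k; simp [finProj]
  refine ⟨mem_dom_star.2 fun i hi => ?_, fun y hy => ?_⟩
  · obtain rfl : i = 0 := by simpa using hi
    simpa [e] using hx
  · simpa [e] using (star_apply hy).2 0 (by simp)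

theorem times_self_le_star (P : Problem) : times P P ≤ star P := by
  refine Reducible.of_total (F := fun w => tail (snd w)) (G := fun x => cons 2 x)
    (total_tail.comp total_snd) (total_id.consing 2) fun x hx => ?_
  have e0 : ∀ w, finProj 2 0 w = fst w := fun w => by funext k; simp [finProj, fst]
  have e1 : ∀ w, finProj 2 1 w = snd w := fun w => by funext k; simp [finProj, snd]
  obtain ⟨h1, h2⟩ := mem_dom_times.1 hx
  refine ⟨mem_dom_star.2 fun i hi => ?_, fun y hy => ⟨?_, ?_⟩⟩
  · have hi : i < 2 := by simpa using hi
    interval_cases i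
    · simpa [e0] using h1
    · simpa [e1] using h2
  · simpa [e0] using (star_apply hy).2 0 (by simp)
  · simpa [e1] using (star_apply hy).2 1 (by simp)

theorem star_times_le (P Q : Problem) : star (times P Q) ≤ times (star P) (star Q) := by
  have hR : TotalFunctional fun _ m => m.unpair.2 := .right
  have h2 : TotalFunctional fun _ m => 2 * m.unpair.2 := .map₂ Primrec.nat_mul (.const 2) hR
  have hG1 := total_starTuple total_head (total_finIndex total_head h2).query
  have hG2 := total_starTuple total_head
    (total_finIndex total_head (.map Primrec.succ h2)).query
  have hn : TotalFunctional fun w _ => fst (snd w) 0 :=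
    TotalFunctional.at (total_fst.comp total_snd) (.const 0)
  have hk : TotalFunctional fun w m => fst (snd w) 0 * (m.unpair.2 / 2) + m.unpair.1 + 1 :=
    total_finIndex hn (.map₂ Primrec.nat_div hR (.const 2))
  have hF := total_starTuple hn (TotalFunctional.ite (.map₂ Primrec.nat_mod hR (.const 2))
      (TotalFunctional.at (total_fst.comp total_snd) hk)
      (TotalFunctional.at (total_snd.comp total_snd) hk))
  refine Reducible.of_total hF (hG1.pairing hG2) fun x hx => ?_
  have hx' := fun i hi => mem_dom_times.1 (mem_dom_star.1 hx i hi)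
  refine ⟨mem_dom_times.2 ⟨mem_dom_star.2 fun i hi => ?_, mem_dom_star.2 fun i hi => ?_⟩, ?_⟩
  · simp only [fst_pair, starTuple_zero] at hi ⊢
    rw [finProj_tail_starTuple hi]
    convert (hx' i hi).1 using 1
    funext k; simp [fst, finProj, tail]
  · simp only [snd_pair, starTuple_zero] at hi ⊢
    rw [finProj_tail_starTuple hi]
    convert (hx' i hi).2 using 1
    funext k; simp [snd, finProj, tail]
  · rintro y ⟨hy1, hy2⟩
    obtain ⟨a1, b1⟩ := star_apply hy1
    obtain ⟨a2, b2⟩ := star_apply hy2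
    simp only [fst_pair, snd_pair, starTuple_zero] at a1 a2 b1 b2
    simp only [snd_pair, a1]
    refine starTuple_mem_star fun i hi => ?_
    have c1 := b1 i hi
    have c2 := b2 i hi
    rw [finProj_tail_starTuple hi] at c1 c2
    refine ⟨?_, ?_⟩
    · convert c1 using 1
      · congr 1; funext k; simp [fst, finProj, tail]
      · funext k; simp [fst, finProj, tail]
    · convert c2 using 1
      · congr 1; funext k; simp [snd, finProj, tail]
      · funext k
        have h1 : (2 * k + 1) % 2 = 1 := by omega
        have h2 : (2 * k + 1) / 2 = k := by omega
        simp [snd, finProj, tail, h1, h2]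

/-- If the domain of `Q` has a computable point then `P ≤ P × Q`. -/
theorem le_times_left (P : Problem) {Q : Problem} (hQ : idBaire ≤ Q) : P ≤ times P Q := by
  obtain ⟨H, K, hH, hK, h⟩ := reducible_iff.1 hQ
  obtain ⟨A, hA, eA⟩ := exists_outputs_pair total_id hK
  refine reducible_iff.2 ⟨_, A, total_fst.comp total_snd, hA, fun x hx => ?_⟩
  obtain ⟨k, hk, o, -⟩ := h x ⟨x, rfl⟩
  refine ⟨pair x k, mem_dom_times.2 (by simpa using ⟨hx, hk⟩), eA _ _ _ (Outputs.of_total _) o, ?_⟩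
  rintro y ⟨hy, -⟩
  exact ⟨fst y, by simpa using hy, fun n => by simp⟩

theorem le_times_right (P : Problem) {Q : Problem} (hQ : idBaire ≤ Q) : P ≤ times Q P := by
  obtain ⟨H, K, hH, hK, h⟩ := reducible_iff.1 hQ
  obtain ⟨A, hA, eA⟩ := exists_outputs_pair hK total_id
  refine reducible_iff.2 ⟨_, A, total_snd.comp total_snd, hA, fun x hx => ?_⟩
  obtain ⟨k, hk, o, -⟩ := h x ⟨x, rfl⟩
  refine ⟨pair k x, mem_dom_times.2 (by simpa using ⟨hk, hx⟩), eA _ _ _ o (Outputs.of_total _), ?_⟩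
  rintro y ⟨-, hy⟩
  exact ⟨snd y, by simpa using hy, fun n => by simp⟩

theorem idBaire_le_star (P : Problem) : idBaire ≤ star P :=
  Reducible.of_total (F := fst) (G := fun _ _ => 0) total_fst (TotalFunctional.const 0)
    fun x _ => ⟨mem_dom_star.2 fun i hi => by simp at hi, fun y _ => by simp [idBaire]⟩

end Problem

/-! ## The Weihrauch degrees -/

/-- Weihrauch degrees of partial multi-valued functions on Baire space. -/
abbrev ProperDegree : Type := Antisymmetrization Problem (· ≤ ·)

namespace ProperDegree

/-- The product of degrees. -/
def times : ProperDegree → ProperDegree → ProperDegree :=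
  Quotient.map₂ Problem.times fun _ _ h1 _ _ h2 =>
    ⟨Problem.times_mono h1.1 h2.1, Problem.times_mono h1.2 h2.2⟩

/-- Finite parallelization of degrees. -/
def star : ProperDegree → ProperDegree :=
  Quotient.map Problem.star fun _ _ h => ⟨Problem.star_mono h.1, Problem.star_mono h.2⟩

/-- Parallelization of degrees. -/
def hat : ProperDegree → ProperDegree :=
  Quotient.map Problem.hat fun _ _ h => ⟨Problem.hat_mono h.1, Problem.hat_mono h.2⟩

instance : SemilatticeInf ProperDegree where
  inf := Quotient.map₂ Problem.oplus fun _ _ h1 _ _ h2 =>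
    ⟨Problem.le_oplus ((Problem.oplus_le_left _ _).trans h1.1)
      ((Problem.oplus_le_right _ _).trans h2.1),
     Problem.le_oplus ((Problem.oplus_le_left _ _).trans h1.2)
      ((Problem.oplus_le_right _ _).trans h2.2)⟩
  inf_le_left a b := Quotient.inductionOn₂ a b Problem.oplus_le_left
  inf_le_right a b := Quotient.inductionOn₂ a b Problem.oplus_le_right
  le_inf a b c := Quotient.inductionOn₃ a b c fun _ _ _ => Problem.le_oplus

end ProperDegree

/-- The Weihrauch degrees `𝔚`, including the artificial top element. -/
abbrev Degree : Type := WithTop ProperDegree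

namespace Degree

/-- The degree of a partial multi-valued function. -/
def of (P : Problem) : Degree := ((toAntisymmetrization (· ≤ ·) P : ProperDegree) : Degree)

/-- The product of degrees, with `a × ⊤ = ⊤ × a = ⊤`. -/
def times : Degree → Degree → Degree := WithTop.map₂ ProperDegree.times

/-- Finite parallelization of degrees, with `⊤* = ⊤`. -/
def star : Degree → Degree := WithTop.map ProperDegree.star

/-- Parallelization of degrees, with `⊤̂ = ⊤`. -/
def hat : Degree → Degree := WithTop.map ProperDegree.hat

/-- A degree is pointed if it lies above the degree of the identity on Baire space. -/
def IsPointed (a : Degree) : Prop := of Problem.idBaire ≤ a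

@[elab_as_elim]
theorem ind {p : Degree → Prop} (top : p ⊤) (of : ∀ P, p (of P)) (a : Degree) : p a := by
  induction a using WithTop.recTopCoe with
  | top => exact top
  | coe a => exact Quotient.inductionOn a of

@[simp] theorem of_le_of {P Q : Problem} : of P ≤ of Q ↔ P ≤ Q :=
  WithTop.coe_le_coe.trans toAntisymmetrization_le_toAntisymmetrization_iff

@[simp] theorem times_of (P Q : Problem) : times (of P) (of Q) = of (P.times Q) := rfl

@[simp] theorem star_of (P : Problem) : star (of P) = of P.star := rfl

@[simp] theorem hat_of (P : Problem) : hat (of P) = of P.hat := rfl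

@[simp] theorem times_top (a : Degree) : times a ⊤ = ⊤ := by cases a <;> rfl

@[simp] theorem top_times (a : Degree) : times ⊤ a = ⊤ := rfl

@[simp] theorem star_top : star ⊤ = ⊤ := rfl

@[simp] theorem hat_top : hat ⊤ = ⊤ := rfl

theorem times_le_times {a b c d : Degree} : a ≤ c → b ≤ d → times a b ≤ times c d := by
  induction c using ind with
  | top => simp
  | of R =>
    induction d using ind with
    | top => simp
    | of S =>
      induction a using ind with
      | top => intro h; simp [of] at h
      | of P =>
        induction b using ind with
        | top => intro _ h; simp [of] at h
        | of Q => simpa using Problem.times_mono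

theorem star_le_star {a b : Degree} : a ≤ b → star a ≤ star b := by
  induction b using ind with
  | top => simp
  | of Q =>
    induction a using ind with
    | top => intro h; simp [of] at h
    | of P => simpa using Problem.star_mono

theorem hat_le_hat {a b : Degree} : a ≤ b → hat a ≤ hat b := by
  induction b using ind with
  | top => simp
  | of Q =>
    induction a using ind with
    | top => intro h; simp [of] at h
    | of P => simpa using Problem.hat_mono

theorem le_star (a : Degree) : a ≤ star a := by
  induction a using ind with
  | top => simp
  | of P => simpa using Problem.le_star P

theorem le_hat (a : Degree) : a ≤ hat a := by
  induction a using ind with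
  | top => simp
  | of P => simpa using Problem.le_hat P

theorem isPointed_star (a : Degree) : IsPointed (star a) := by
  induction a using ind with
  | top => simp [IsPointed]
  | of P => simpa [IsPointed] using Problem.idBaire_le_star P

theorem le_times_left {a b : Degree} : IsPointed b → a ≤ times a b := by
  induction b using ind with
  | top => simp
  | of Q =>
    induction a using ind with
    | top => simp
    | of P => simpa [IsPointed] using Problem.le_times_left P

theorem le_times_right {a b : Degree} : IsPointed a → b ≤ times a b := by
  induction a using ind with
  | top => simp
  | of Q =>
    induction b using ind with
    | top => simp
    | of P => simpa [IsPointed] using Problem.le_times_right P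

theorem times_self_le_star (a : Degree) : times a a ≤ star a := by
  induction a using ind with
  | top => simp
  | of P => simpa using Problem.times_self_le_star P

theorem times_self_le_hat (a : Degree) : times a a ≤ hat a := by
  induction a using ind with
  | top => simp
  | of P => simpa using Problem.times_self_le_hat P

theorem star_times_le (a b : Degree) : star (times a b) ≤ times (star a) (star b) := by
  induction a using ind with
  | top => simp
  | of P =>
    induction b using ind with
    | top => simp
    | of Q => simpa using Problem.star_times_le P Q

theorem hat_times_le (a b : Degree) : hat (times a b) ≤ times (hat a) (hat b) := by
  induction a using ind with
  | top => simp
  | of P =>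
    induction b using ind with
    | top => simp
    | of Q => simpa using Problem.hat_times_le P Q

end Degree

/-! ## The lattices `𝔚*` and `p𝔚̂` -/

/-- `𝔚*`: the degrees fixed by finite parallelization. -/
def StarDegree : Type := {a : Degree // a.star = a}

/-- `p𝔚̂`: the pointed degrees fixed by parallelization. -/
def PointedHatDegree : Type := {a : Degree // a.IsPointed ∧ a.hat = a}

/-- `𝔚*` with the order of `𝔚`, infimum `⊕` and supremum `×`. -/
instance : Lattice StarDegree where
  le a b := a.1 ≤ b.1
  le_refl a := le_refl a.1
  le_trans _ _ _ h1 h2 := le_trans (α := Degree) h1 h2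
  le_antisymm _ _ h1 h2 := Subtype.ext (le_antisymm h1 h2)
  sup a b := ⟨a.1.times b.1, le_antisymm
    ((Degree.star_times_le _ _).trans_eq (by rw [a.2, b.2])) (Degree.le_star _)⟩
  le_sup_left a b := Degree.le_times_left (b.2 ▸ Degree.isPointed_star b.1)
  le_sup_right a b := Degree.le_times_right (a.2 ▸ Degree.isPointed_star a.1)
  sup_le _ _ c h1 h2 := ((Degree.times_le_times h1 h2).trans
    (Degree.times_self_le_star c.1)).trans_eq c.2
  inf a b := ⟨a.1 ⊓ b.1, le_antisymm
    (le_inf ((Degree.star_le_star inf_le_left).trans_eq a.2)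
      ((Degree.star_le_star inf_le_right).trans_eq b.2)) (Degree.le_star _)⟩
  inf_le_left a b := inf_le_left (a := a.1) (b := b.1)
  inf_le_right a b := inf_le_right (a := a.1) (b := b.1)
  le_inf _ _ _ h1 h2 := le_inf (α := Degree) h1 h2

/-- `p𝔚̂` with the order of `𝔚`, infimum `⊕` and supremum `×`. -/
instance : Lattice PointedHatDegree where
  le a b := a.1 ≤ b.1
  le_refl a := le_refl a.1
  le_trans _ _ _ h1 h2 := le_trans (α := Degree) h1 h2
  le_antisymm _ _ h1 h2 := Subtype.ext (le_antisymm h1 h2)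
  sup a b := ⟨a.1.times b.1, a.2.1.trans (Degree.le_times_left b.2.1), le_antisymm
    ((Degree.hat_times_le _ _).trans_eq (by rw [a.2.2, b.2.2])) (Degree.le_hat _)⟩
  le_sup_left a b := Degree.le_times_left b.2.1
  le_sup_right a b := Degree.le_times_right a.2.1
  sup_le _ _ c h1 h2 := ((Degree.times_le_times h1 h2).trans
    (Degree.times_self_le_hat c.1)).trans_eq c.2.2
  inf a b := ⟨a.1 ⊓ b.1, le_inf a.2.1 b.2.1, le_antisymm
    (le_inf ((Degree.hat_le_hat inf_le_left).trans_eq a.2.2)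
      ((Degree.hat_le_hat inf_le_right).trans_eq b.2.2)) (Degree.le_hat _)⟩
  inf_le_left a b := inf_le_left (a := a.1) (b := b.1)
  inf_le_right a b := inf_le_right (a := a.1) (b := b.1)
  le_inf _ _ _ h1 h2 := le_inf (α := Degree) h1 h2

/-- A lattice is a Brouwer algebra if for all `a, b` the set `{c | b ≤ c ∨ a}` has a least
element. -/
def IsBrouwerAlgebra (L : Type*) [Lattice L] : Prop :=
  ∀ a b : L, ∃ m : L, IsLeast {c : L | b ≤ c ⊔ a} m

end Weihrauch

namespace Weihrauch

open Topology

/-! Take a point `x` of Baire space none of whose columns is computable from the remaining ones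
(`exists_independent`), and a set `D` of numbers such that every computable sequence with values in
`D` misses an element of `D` (`exists_not_range`). Let `P = column D x` return the column of `x`
named by its input, for names in `D` only, and let `Q = const x`. For `n ∈ D`, let `r` be `x` with
column `n` erased. Then `const r` solves `const x ≤ P̂ × R`: one call of `P` on the fixed number `n`
restores the missing column (`const_le_times_eraseColumn`).

A least solution `M` would lie below all these constants, which is impossible
(`exists_not_le_const`). On a computable input, the reduction of `const x` to `P̂ × M` asks `P̂` for
a computable sequence of columns with names in `D`, so some `n ∈ D` is never asked for. With `r` as
above for this `n`, all answers of `P̂` can be read off `r`, and `M ≤ const r` lets `r` solve the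
instance of `M` as well. Hence `r` computes `x`, in particular column `n`, against independence.

The same witnesses settle every version of the claim. Constant problems are pointed and fixed by
both parallelizations, so they belong to each of the sets and lattices considered. The degree of
`P̂` lies in both lattices because `0 ∈ D` puts a computable point into the domain of `P`.

Both choices rest on there being only countably many functionals: `D` comes from a diagonal
argument, and `x` from Baire category together with the continuity of functionals. -/

/-! ## Countability and continuity of partial recursive functionals -/

/-- Syntax of partial recursive functionals. -/
inductive FunctionalCode : Type
  | zero | succ | left | right | oracle
  | pair (c d : FunctionalCode)
  | comp (c d : FunctionalCode)
  | prec (c d : FunctionalCode)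
  | rfind (c : FunctionalCode)
  deriving Countable

/-- The functional denoted by a code. -/
def FunctionalCode.eval : FunctionalCode → Baire → ℕ →. ℕ
  | zero => fun _ _ => Part.some 0
  | succ => fun _ n => Part.some (n + 1)
  | left => fun _ n => Part.some n.unpair.1
  | right => fun _ n => Part.some n.unpair.2
  | oracle => fun p n => Part.some (p n)
  | pair c d => fun p n => (c.eval p n).bind fun a => (d.eval p n).bind fun b =>
      Part.some (Nat.pair a b)
  | comp c d => fun p n => (d.eval p n).bind fun a => c.eval p a
  | prec c d => fun p m =>
      Nat.rec (motive := fun _ => Part ℕ) (c.eval p m.unpair.1)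
        (fun y ih => ih.bind fun i => d.eval p (Nat.pair m.unpair.1 (Nat.pair y i))) m.unpair.2
  | rfind c => fun p a =>
      Nat.rfind fun n => (c.eval p (Nat.pair a n)).map fun m => decide (m = 0)

theorem PartrecFunctional.exists_code {Ψ : Baire → ℕ →. ℕ} (h : PartrecFunctional Ψ) :
    ∃ c : FunctionalCode, c.eval = Ψ := by
  induction h with
  | zero => exact ⟨.zero, rfl⟩
  | succ => exact ⟨.succ, rfl⟩
  | left => exact ⟨.left, rfl⟩
  | right => exact ⟨.right, rfl⟩
  | oracle => exact ⟨.oracle, rfl⟩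
  | pair _ _ h1 h2 =>
    obtain ⟨c, rfl⟩ := h1
    obtain ⟨d, rfl⟩ := h2
    exact ⟨.pair c d, rfl⟩
  | comp _ _ h1 h2 =>
    obtain ⟨c, rfl⟩ := h1
    obtain ⟨d, rfl⟩ := h2
    exact ⟨.comp c d, rfl⟩
  | prec _ _ h1 h2 =>
    obtain ⟨c, rfl⟩ := h1
    obtain ⟨d, rfl⟩ := h2
    exact ⟨.prec c d, rfl⟩
  | rfind _ h1 =>
    obtain ⟨c, rfl⟩ := h1
    exact ⟨.rfind c, rfl⟩

theorem countable_partrecFunctional : {Ψ | PartrecFunctional Ψ}.Countable :=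
  (Set.countable_range FunctionalCode.eval).mono fun _ h => h.exists_code

/-- Partial recursive functionals are continuous: each value depends on a finite part of the
oracle. -/
theorem PartrecFunctional.isOpen_mem {Ψ : Baire → ℕ →. ℕ} (h : PartrecFunctional Ψ) :
    ∀ n v, IsOpen {p : Baire | v ∈ Ψ p n} := by
  have bind {f : Baire → Part ℕ} {g : Baire → ℕ → Part ℕ} (hf : ∀ a, IsOpen {p | a ∈ f p})
      (hg : ∀ a v, IsOpen {p | v ∈ g p a}) (v : ℕ) : IsOpen {p | v ∈ (f p).bind (g p)} := by
    simp only [Part.mem_bind_iff, Set.ofPred_exists, Set.ofPred_and]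
    exact isOpen_iUnion fun a => (hf a).inter (hg a v)
  induction h with
  | zero => exact fun n v => isOpen_const
  | succ => exact fun n v => isOpen_const
  | left => exact fun n v => isOpen_const
  | right => exact fun n v => isOpen_const
  | oracle =>
    intro n v
    simp only [Part.mem_some_iff]
    exact (isOpen_discrete {m : ℕ | v = m}).preimage (continuous_apply n)
  | pair _ _ h1 h2 =>
    exact fun n => bind (h1 n) fun a => bind (h2 n) fun b v => isOpen_const
  | comp _ _ h1 h2 => exact fun n => bind (h2 n) h1
  | prec _ _ h1 h2 =>
    -- The depth of the recursion depends on the argument only, not on the oracle, so induction on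
    -- it suffices.
    intro n
    beta_reduce
    induction n.unpair.2 with
    | zero => exact h1 _
    | succ y ih => exact bind ih fun i => h2 _
  | rfind _ h1 =>
    intro n v
    rename_i f _
    have hmap (m : ℕ) (b : Bool) : IsOpen {p : Baire |
        b ∈ (f p (Nat.pair n m)).map fun m => decide (m = 0)} := by
      simp only [Part.mem_map_iff, Set.ofPred_exists, Set.ofPred_and]
      exact isOpen_iUnion fun a => (h1 (Nat.pair n m) a).inter isOpen_const
    -- A search that stops at `v` imposes finitely many conditions: success at `v` and a defined
    -- failure at each smaller number.
    convert (hmap v true).inter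
      ((Set.finite_lt_nat v).isOpen_biInter fun m _ => hmap m false) using 1
    ext p
    simp only [Set.mem_inter_iff, Set.mem_iInter]
    exact Nat.mem_rfind

/-! ## Relative computability -/

/-- `q` is computable relative to `p`. -/
def Computes (p q : Baire) : Prop :=
  ∃ Ψ, PartrecFunctional Ψ ∧ Outputs Ψ p q

theorem Computes.of_total {F : Baire → Baire} (hF : TotalFunctional F) (p : Baire) :
    Computes p (F p) :=
  ⟨_, hF, Outputs.of_total p⟩

theorem Computes.trans {p q r : Baire} (h1 : Computes p q) (h2 : Computes q r) :
    Computes p r := by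
  obtain ⟨Ψ, hΨ, o1⟩ := h1
  obtain ⟨Θ, hΘ, o2⟩ := h2
  obtain ⟨Ξ, hΞ, e⟩ := exists_outputs_comp hΘ hΨ
  exact ⟨Ξ, hΞ, e _ _ _ o1 o2⟩

theorem Computes.pair {p q r : Baire} (h1 : Computes p q) (h2 : Computes p r) :
    Computes p (pair q r) := by
  obtain ⟨Ψ, hΨ, o1⟩ := h1
  obtain ⟨Θ, hΘ, o2⟩ := h2
  obtain ⟨Ξ, hΞ, e⟩ := exists_outputs_pair hΨ hΘ
  exact ⟨Ξ, hΞ, e _ _ _ o1 o2⟩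

/-- Each functional outputs at most one sequence with oracle `p`. Undefined values are filled with
`0` only to obtain a total map on the countable set of functionals. -/
theorem countable_computes (p : Baire) : {q | Computes p q}.Countable := by
  classical
  refine (countable_partrecFunctional.image fun Ψ n =>
    if h : (Ψ p n).Dom then (Ψ p n).get h else 0).mono ?_
  rintro q ⟨Ψ, hΨ, o⟩
  exact ⟨Ψ, hΨ, funext fun n => by simp [o n]⟩

/-- There is a set of numbers that is not the range of a computable sequence. -/
theorem exists_not_range : ∃ D : Set ℕ, 0 ∈ D ∧ ∀ k : Baire, Computes (fun _ => 0) k →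
    (∀ i, k i ∈ D) → ∃ n ∈ D, ∀ i, k i ≠ n := by
  obtain ⟨f, hf⟩ := (countable_computes fun _ => 0).exists_eq_range
    ⟨_, Computes.of_total Problem.total_id _⟩
  -- Diagonalization: `e + 1` is put into `D` exactly when the `e`-th computable sequence omits it.
  -- A sequence `f e` inside `D` cannot take the value `e + 1`, so it omits this element of `D`. The
  -- shift by one leaves `0` free to be a member.
  refine ⟨{n | n = 0 ∨ ∀ i, f (n - 1) i ≠ n}, Or.inl rfl, fun k hk hD => ?_⟩
  obtain ⟨e, rfl⟩ : k ∈ Set.range f := hf ▸ hk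
  have : ∀ i, f e i ≠ e + 1 := fun i hi => by
    rcases hD i with h | h
    · omega
    · rw [hi] at h
      exact h i hi
  exact ⟨e + 1, Or.inr this, this⟩

/-! ### Independent columns by Baire category -/

/-- The sequence of columns of `x`, with the `n`-th one replaced by zero. -/
def eraseColumn (n : ℕ) (x : Baire) : Baire := fun m => if m.unpair.1 = n then 0 else x m

theorem continuous_eraseColumn (n : ℕ) : Continuous (eraseColumn n) :=
  continuous_pi fun m => by
    unfold eraseColumn
    split_ifs
    · exact continuous_const
    · exact continuous_apply m

/-- The functional does not see column `n`, whereas arbitrarily small perturbations of `x` change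
that column. A correct prediction is therefore refuted arbitrarily close by, and by continuity the
refutation is an open condition. -/
theorem isNowhereDense_outputs_eraseColumn {Ψ : Baire → ℕ →. ℕ} (hΨ : PartrecFunctional Ψ)
    (n : ℕ) : IsNowhereDense {x | Outputs Ψ (eraseColumn n x) (proj n x)} := by
  set E := {x | Outputs Ψ (eraseColumn n x) (proj n x)} with hE
  let O : Set Baire := {x | ∃ k v, v ∈ Ψ (eraseColumn n x) k ∧ v ≠ x (Nat.pair n k)}
  have hO : IsOpen O := by
    simp only [O, Set.ofPred_exists, Set.ofPred_and]
    exact isOpen_iUnion fun k => isOpen_iUnion fun v =>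
      ((hΨ.isOpen_mem k v).preimage (continuous_eraseColumn n)).inter
        ((isOpen_discrete {m : ℕ | v ≠ m}).preimage
          (continuous_apply (A := fun _ : ℕ => ℕ) (Nat.pair n k)))
  have hEO : closure E ⊆ Oᶜ := by
    refine closure_minimal (fun x hx => ?_) hO.isClosed_compl
    rintro ⟨k, v, hv, hne⟩
    rw [hx k, Part.mem_some_iff] at hv
    exact hne hv
  refine Set.eq_empty_iff_forall_notMem.2 fun y hy => ?_
  obtain ⟨x, hx, hxE⟩ := mem_closure_iff.1 (interior_subset hy) _ isOpen_interior hy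
  -- One entry of column `n` is changed, at a place that moves off to infinity, so that `x' N` tends
  -- to `x` while the erased sequence stays the same.
  let x' (N : ℕ) : Baire := Function.update x (Nat.pair n N) (x (Nat.pair n N) + 1)
  have hx' : Filter.Tendsto x' Filter.atTop (𝓝 x) := by
    refine tendsto_pi_nhds.2 fun m => tendsto_const_nhds.congr' ?_
    filter_upwards [Filter.eventually_gt_atTop m] with N hN
    have : m ≠ Nat.pair n N := (hN.trans_le (Nat.right_le_pair n N)).ne
    simp [x', this]
  obtain ⟨N, hN⟩ := (hx'.eventually (isOpen_interior.mem_nhds hx)).exists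
  refine hEO (interior_subset hN) ⟨N, x (Nat.pair n N), ?_, by simp [x']⟩
  have : eraseColumn n (x' N) = eraseColumn n x := by
    funext m
    by_cases hm : m.unpair.1 = n
    · simp [eraseColumn, hm]
    · have : m ≠ Nat.pair n N := fun h => hm (by simp [h])
      simp [eraseColumn, x', this]
  rw [this, hxE N]
  simp [proj]

/-- There is a sequence of points of Baire space none of which is computable from the others. -/
theorem exists_independent : ∃ x : Baire, ∀ n, ¬ Computes (eraseColumn n x) (proj n x) := by
  -- The bad points form a countable union, over functionals and columns, of nowhere dense sets; its
  -- complement is dense, hence nonempty.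
  have hm : IsMeagre (⋃ Ψ ∈ {Ψ | PartrecFunctional Ψ}, ⋃ n,
      {x | Outputs Ψ (eraseColumn n x) (proj n x)}) :=
    isMeagre_biUnion countable_partrecFunctional fun Ψ hΨ => isMeagre_iUnion fun n =>
      (isNowhereDense_outputs_eraseColumn hΨ n).isMeagre
  obtain ⟨x, hx⟩ := (dense_of_mem_residual hm).nonempty
  refine ⟨x, fun n ⟨Ψ, hΨ, o⟩ => hx ?_⟩
  simp only [Set.mem_iUnion]
  exact ⟨Ψ, hΨ, n, o⟩


/-! ### Commutativity of the product and idempotence of parallelization -/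

namespace Problem

theorem times_comm_le (P Q : Problem) : times P Q ≤ times Q P :=
  Reducible.of_total ((total_snd.comp total_snd).pairing (total_fst.comp total_snd))
    (total_snd.pairing total_fst) fun x hx => by
      obtain ⟨h1, h2⟩ := mem_dom_times.1 hx
      refine ⟨mem_dom_times.2 (by simpa using ⟨h2, h1⟩), ?_⟩
      rintro y ⟨hy1, hy2⟩
      exact ⟨by simpa using hy2, by simpa using hy1⟩

/-- A doubly indexed family of instances is flattened along `Nat.pair`. -/
theorem hat_hat_le (P : Problem) : hat (hat P) ≤ hat P := by
  have hL : TotalFunctional fun _ m => m.unpair.1 := .left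
  have hR : TotalFunctional fun _ m => m.unpair.2 := .right
  have hG : TotalFunctional fun x => tuple fun m => proj m.unpair.2 (proj m.unpair.1 x) :=
    ((hL.at hL).pair ((hR.at hL).pair hR)).query
  have hF : TotalFunctional fun x => tuple fun i => tuple fun j => proj (Nat.pair i j) x :=
    ((hL.pair (hL.at hR)).pair (hR.at hR)).query
  refine Reducible.of_total (hF.comp total_snd) hG fun x hx => ?_
  refine ⟨mem_dom_hat.2 fun m => ?_, fun y hy i j => ?_⟩
  · simpa using mem_dom_hat.1 (mem_dom_hat.1 hx _) _
  · simpa using hy (Nat.pair i j)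

/-- If the zero sequence is in the domain of `P`, then `P̂` is fixed by finite parallelization. -/
theorem star_hat_le {P : Problem} (h0 : (fun _ => 0) ∈ P.dom) : star (hat P) ≤ hat P := by
  have hL : TotalFunctional fun _ m => m.unpair.1 := .left
  have hR : TotalFunctional fun _ m => m.unpair.2 := .right
  -- The truncated difference vanishes exactly when the outer index is at least the length `w 0`.
  have hlt : TotalFunctional fun w m => w 0 - m.unpair.1.unpair.1 :=
    .map₂ Primrec.nat_sub total_head (hL.at hL)
  have hmul : TotalFunctional fun w m => w 0 * Nat.pair m.unpair.1.unpair.2 m.unpair.2 :=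
    .map₂ Primrec.nat_mul total_head ((hR.at hL).pair hR)
  have hadd : TotalFunctional fun w m =>
      w 0 * Nat.pair m.unpair.1.unpair.2 m.unpair.2 + m.unpair.1.unpair.1 :=
    .map₂ Primrec.nat_add hmul (hL.at hL)
  have hidx : TotalFunctional fun w m =>
      w 0 * Nat.pair m.unpair.1.unpair.2 m.unpair.2 + m.unpair.1.unpair.1 + 1 :=
    .map Primrec.succ hadd
  -- Component `⟨i, j⟩` of the query is the `j`-th instance in the `i`-th entry of the tuple; the `+
  -- 1` in `hidx` skips the leading length. Indices `i` beyond the length are padded with the zero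
  -- sequence, which is where `h0` enters; this also covers length `0`.
  have hG := TotalFunctional.ite hlt (.const 0) hidx.query
  have hF := total_starTuple (TotalFunctional.at total_fst (.const 0))
    (total_snd.at ((hL.pair (hL.at hR)).pair (hR.at hR)))
  refine Reducible.of_total hF hG fun x hx => ?_
  have hx' := mem_dom_star.1 hx
  have e1 : ∀ i j, i < x 0 → (proj (Nat.pair i j) fun n =>
      if x 0 - n.unpair.1.unpair.1 = 0 then 0 else
        x (x 0 * Nat.pair n.unpair.1.unpair.2 n.unpair.2 + n.unpair.1.unpair.1 + 1)) =
      proj j (finProj (x 0) i (tail x)) := fun i j hi => by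
    funext k
    have : x 0 - i ≠ 0 := by omega
    simp [proj, finProj, tail, this]
  have e2 : ∀ i j, ¬ i < x 0 → (proj (Nat.pair i j) fun n =>
      if x 0 - n.unpair.1.unpair.1 = 0 then 0 else
        x (x 0 * Nat.pair n.unpair.1.unpair.2 n.unpair.2 + n.unpair.1.unpair.1 + 1)) =
      fun _ => 0 := fun i j hi => by
    funext k
    have : x 0 - i = 0 := by omega
    simp [proj, this]
  refine ⟨mem_dom_hat.2 fun m => ?_, fun y hy => ?_⟩
  · rw [← Nat.pair_unpair m]
    by_cases hi : m.unpair.1 < x 0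
    · rw [e1 _ _ hi]
      exact mem_dom_hat.1 (hx' _ hi) _
    · rwa [e2 _ _ hi]
  · simp only [fst_pair, snd_pair]
    refine starTuple_mem_star fun i hi j => ?_
    have := hy (Nat.pair i j)
    rw [e1 _ _ hi] at this
    convert this using 1
    funext k
    simp [proj]

/-! ### Constant problems and the column problem -/

/-- The constant problem with value `r`. -/
def const (r : Baire) : Problem := fun _ => {r}

theorem const_dom (r x : Baire) : x ∈ (const r).dom := ⟨r, rfl⟩

theorem idBaire_le_const (r : Baire) : idBaire ≤ const r :=
  Reducible.of_total total_fst total_id fun x _ =>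
    ⟨const_dom r x, fun y _ => by simp [idBaire]⟩

/-- A single call suffices, since its answer `r` can be copied into every component. -/
theorem hat_const_le (r : Baire) : hat (const r) ≤ const r := by
  have hR : TotalFunctional fun _ m => m.unpair.2 := .right
  have hF : TotalFunctional fun x => tuple fun _ => x := hR.query
  refine Reducible.of_total (hF.comp total_snd) total_id fun x _ => ⟨const_dom r x, ?_⟩
  rintro y rfl i
  simp [const]

theorem star_const_le (r : Baire) : star (const r) ≤ const r := by
  have hR : TotalFunctional fun _ m => m.unpair.2 := .right
  have hF := total_starTuple (TotalFunctional.at total_fst (.const 0)) (total_snd.at hR)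
  refine Reducible.of_total hF total_id fun x _ => ⟨const_dom r x, ?_⟩
  rintro y rfl
  simp only [fst_pair, snd_pair, Nat.unpair_pair]
  exact starTuple_mem_star fun i _ => rfl

/-- The problem of computing the `z(0)`-th column of `x` from `z`, for `z(0) ∈ D`. -/
def column (D : Set ℕ) (x : Baire) : Problem := fun z => {y | z 0 ∈ D ∧ y = proj (z 0) x}

theorem mem_dom_column {D : Set ℕ} {x z : Baire} : z ∈ (column D x).dom ↔ z 0 ∈ D :=
  ⟨fun ⟨_, h, _⟩ => h, fun h => ⟨_, h, rfl⟩⟩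

theorem idBaire_le_column {D : Set ℕ} (h0 : 0 ∈ D) (x : Baire) : idBaire ≤ column D x :=
  Reducible.of_total (F := fst) (G := fun _ _ => 0) total_fst (TotalFunctional.const 0)
    fun _ _ => ⟨mem_dom_column.2 h0, fun y _ => by simp [idBaire]⟩

/-- The number `n` is hard-wired into the reduction, so only `n ∈ D` is needed and `D` itself need
not be computable. -/
theorem const_le_times_eraseColumn {D : Set ℕ} {n : ℕ} (hn : n ∈ D) (x : Baire) :
    const x ≤ times (hat (column D x)) (const (eraseColumn n x)) := by
  have hL : TotalFunctional fun _ m => m.unpair.1 := .left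
  have hR : TotalFunctional fun _ m => m.unpair.2 := .right
  -- The distance between the column index and `n`, which is zero exactly on the erased column.
  have hd : TotalFunctional fun _ m => (m.unpair.1 - n) + (n - m.unpair.1) :=
    .map₂ Primrec.nat_add (.map₂ Primrec.nat_sub hL (.const n))
      (.map₂ Primrec.nat_sub (.const n) hL)
  have hF := TotalFunctional.ite hd ((total_fst.comp total_snd).at ((TotalFunctional.const 0).pair hR))
    (total_snd.comp total_snd)
  -- Every component of the constant sequence `n` starts with `n`, so each one is a query for column
  -- `n`; only the answer in component `0` is used.
  refine Reducible.of_total (G := fun _ => pair (fun _ => n) (fun _ => 0)) hF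
    (TotalFunctional.pairing (.const n) (.const 0)) fun z _ => ?_
  refine ⟨mem_dom_times.2 ⟨mem_dom_hat.2 fun i => mem_dom_column.2 ?_, const_dom _ _⟩, ?_⟩
  · simpa [proj] using hn
  · rintro y ⟨hy1, hy2⟩
    simp only [fst_pair] at hy1
    have h1 : proj 0 (fst y) = proj n x := (hy1 0).2
    have h2 : snd y = eraseColumn n x := hy2
    refine funext fun m => ?_
    simp only [snd_pair, h2]
    by_cases hm : m.unpair.1 = n
    · have := congrFun h1 m.unpair.2
      simp only [proj] at this
      rw [if_pos (by omega), this, ← hm, Nat.pair_unpair]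
    · rw [if_neg (by omega), eraseColumn, if_neg hm]

/-- If every column of `x` is not computable from the others and `D` is not the range of a
computable sequence, then no solution of `const x ≤ column D x^ × M` is least. -/
theorem exists_not_le_const {D : Set ℕ} {x : Baire}
    (hD : ∀ k : Baire, Computes (fun _ => 0) k → (∀ i, k i ∈ D) → ∃ n ∈ D, ∀ i, k i ≠ n)
    (hx : ∀ n, ¬ Computes (eraseColumn n x) (proj n x)) {M : Problem}
    (hM : const x ≤ times (hat (column D x)) M) :
    ∃ n ∈ D, ¬ M ≤ const (eraseColumn n x) := by
  have hL : TotalFunctional fun _ m => m.unpair.1 := .left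
  have hR : TotalFunctional fun _ m => m.unpair.2 := .right
  obtain ⟨Ψ, Θ, hΨ, hΘ, h⟩ := reducible_iff.1 hM
  -- Any input is an instance of `const x`; a computable one makes the query `k` computable.
  obtain ⟨k, hk, o, hq⟩ := h (fun _ => 0) (const_dom _ _)
  obtain ⟨hk1, hk2⟩ := mem_dom_times.1 hk
  have hk : Computes (fun _ => 0) k := ⟨Θ, hΘ, o⟩
  have hH : TotalFunctional fun w i => fst w (Nat.pair i 0) :=
    total_fst.at (TotalFunctional.ident.pair (.const 0))
  -- The names of the columns requested from `P̂` form a computable sequence in `D`, so some `n ∈ D`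
  -- is never requested.
  obtain ⟨n, hn, hne⟩ := hD (fun i => fst k (Nat.pair i 0)) (hk.trans (.of_total hH k))
    fun i => mem_dom_column.1 (mem_dom_hat.1 hk1 i)
  refine ⟨n, hn, fun hle => hx n ?_⟩
  set r := eraseColumn n x with hr
  have hr0 : Computes r fun _ => 0 := .of_total (F := fun _ _ => 0) (.const 0) r
  have hrk : Computes r k := hr0.trans hk
  obtain ⟨Ψ', Θ', hΨ', hΘ', h'⟩ := reducible_iff.1 hle
  -- The query `l` to `const r` can be ignored: its only answer is `r`. A solution `z` of the
  -- `M`-instance is thus computed from `snd k` and `r`.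
  obtain ⟨l, -, -, hl⟩ := h' (snd k) hk2
  obtain ⟨z, hz, oz⟩ := hl r rfl
  have hrz : Computes r z :=
    ((hrk.trans (.of_total total_snd k)).pair (.of_total total_id r)).trans ⟨Ψ', hΨ', oz⟩
  -- the answer to the query of `hat (column D x)` does not use the erased column
  have hu : TotalFunctional fun w m =>
      snd w (Nat.pair (fst (fst w) (Nat.pair m.unpair.1 0)) m.unpair.2) :=
    total_snd.at ((TotalFunctional.at (total_fst.comp total_fst) (hL.pair (.const 0))).pair hR)
  have hru := (hrk.pair (.of_total total_id r)).trans (.of_total hu _)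
  obtain ⟨q, rfl, oq⟩ := hq (Weihrauch.pair (fun m =>
      r (Nat.pair (fst k (Nat.pair m.unpair.1 0)) m.unpair.2)) z) <| by
    refine ⟨fun i => ⟨mem_dom_column.1 (mem_dom_hat.1 hk1 i), ?_⟩, by simpa using hz⟩
    funext j
    simp [proj, hr, eraseColumn, hne i]
  simp only [fst_pair, snd_pair] at hru
  have hrx := (hr0.pair (hru.pair hrz)).trans ⟨Ψ, hΨ, oq⟩
  exact hrx.trans (.of_total (F := proj n) ((TotalFunctional.const n).pair .ident).query _)

end Problem

/-! ### Transfer to degrees -/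

namespace Degree

/-- Needed because the definition of a Brouwer algebra has the unknown as the left factor, while
`exists_no_least` has it as the right one. -/
theorem times_comm (a b : Degree) : times a b = times b a := by
  have (a b : Degree) : times a b ≤ times b a := by
    induction a using ind with
    | top => simp
    | of P =>
      induction b using ind with
      | top => simp
      | of Q => simpa using Problem.times_comm_le P Q
  exact le_antisymm (this a b) (this b a)

theorem hat_hat (a : Degree) : a.hat.hat = a.hat := by
  refine le_antisymm ?_ (le_hat _)
  induction a using ind with
  | top => simp
  | of P => simpa using Problem.hat_hat_le P

theorem hat_const (r : Baire) : (of (Problem.const r)).hat = of (Problem.const r) :=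
  le_antisymm (by simpa using Problem.hat_const_le r) (le_hat _)

theorem star_const (r : Baire) : (of (Problem.const r)).star = of (Problem.const r) :=
  le_antisymm (by simpa using Problem.star_const_le r) (le_star _)

theorem star_hat_of {P : Problem} (h0 : (fun _ => 0) ∈ P.dom) :
    (of P).hat.star = (of P).hat :=
  le_antisymm (by simpa using Problem.star_hat_le h0) (le_star _)

/-- There are a pointed `P` and an `x` such that every solution `M` of `const x ≤ P̂ × M` fails to
be below some constant solution. -/
theorem exists_no_least : ∃ (P : Problem) (x : Baire), (fun _ => 0) ∈ P.dom ∧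
    (of P).IsPointed ∧ ∀ M : Degree, of (Problem.const x) ≤ (of P).hat.times M →
      ∃ r, of (Problem.const x) ≤ (of P).hat.times (of (Problem.const r)) ∧
        ¬ M ≤ of (Problem.const r) := by
  obtain ⟨D, h0, hD⟩ := exists_not_range
  obtain ⟨x, hx⟩ := exists_independent
  refine ⟨Problem.column D x, x, Problem.mem_dom_column.2 h0,
    of_le_of.2 (Problem.idBaire_le_column h0 x), fun M hM => ?_⟩
  induction M using ind with
  | top =>
    -- The artificial top is not below any proper degree, so any constant solution works; `0 ∈ D`
    -- supplies one.
    exact ⟨_, by simpa using Problem.const_le_times_eraseColumn h0 x, by simp [of]⟩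
  | of M =>
    obtain ⟨n, hn, hle⟩ := Problem.exists_not_le_const hD hx (by simpa using hM)
    exact ⟨_, by simpa using Problem.const_le_times_eraseColumn hn x, by simpa using hle⟩

end Degree

end Weihrauch

/-! ### The main theorem -/

theorem theorem21 :
    ¬ Weihrauch.IsBrouwerAlgebra Weihrauch.StarDegree ∧
    ¬ Weihrauch.IsBrouwerAlgebra Weihrauch.PointedHatDegree ∧
    ∃ P Q : Weihrauch.Problem,
      (Weihrauch.Degree.of P).IsPointed ∧ (Weihrauch.Degree.of Q).IsPointed ∧
      (¬ ∃ M : Weihrauch.Degree, IsLeast {R : Weihrauch.Degree |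
        (Weihrauch.Degree.of Q).hat ≤ (Weihrauch.Degree.of P).hat.times R} M) ∧
      (¬ ∃ M : Weihrauch.Degree, IsLeast {R : Weihrauch.Degree |
        (Weihrauch.Degree.of Q).hat ≤ (Weihrauch.Degree.of P).hat.times R ∧ R.hat = R} M) ∧
      (¬ ∃ M : Weihrauch.Degree, IsLeast {R : Weihrauch.Degree |
        (Weihrauch.Degree.of Q).hat ≤ (Weihrauch.Degree.of P).hat.times R ∧ R.star = R} M) := by
  obtain ⟨P, x, h0, hP, h⟩ := Weihrauch.Degree.exists_no_least
  have hconst (r : Weihrauch.Baire) :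
      (Weihrauch.Degree.of (Weihrauch.Problem.const r)).IsPointed :=
    Weihrauch.Degree.of_le_of.2 (Weihrauch.Problem.idBaire_le_const r)
  refine ⟨fun hB => ?_, fun hB => ?_, P, Weihrauch.Problem.const x, hP, hconst x, ?_, ?_, ?_⟩
  -- The instance that fails has `a` the degree of `P̂` and `b` that of `const x`; a least element
  -- would lie below each constant solution `const r`, which is itself in the lattice.
  · obtain ⟨M, hM, hl⟩ := hB ⟨_, Weihrauch.Degree.star_hat_of h0⟩
      ⟨_, Weihrauch.Degree.star_const x⟩
    obtain ⟨r, hr, hMr⟩ := h M.1 (le_of_le_of_eq (α := Weihrauch.Degree) hM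
      (Weihrauch.Degree.times_comm _ _))
    exact hMr (@hl ⟨_, Weihrauch.Degree.star_const r⟩
      (le_of_le_of_eq (α := Weihrauch.Degree) hr (Weihrauch.Degree.times_comm _ _)))
  · obtain ⟨M, hM, hl⟩ := hB ⟨_, hP.trans (Weihrauch.Degree.le_hat _), Weihrauch.Degree.hat_hat _⟩
      ⟨_, hconst x, Weihrauch.Degree.hat_const x⟩
    obtain ⟨r, hr, hMr⟩ := h M.1 (le_of_le_of_eq (α := Weihrauch.Degree) hM
      (Weihrauch.Degree.times_comm _ _))
    exact hMr (@hl ⟨_, hconst r, Weihrauch.Degree.hat_const r⟩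
      (le_of_le_of_eq (α := Weihrauch.Degree) hr (Weihrauch.Degree.times_comm _ _)))
  -- Parallelizing `Q = const x` does not change its degree, so the three sets are instances of the
  -- inequality in `h`.
  all_goals rw [Weihrauch.Degree.hat_const]
  · rintro ⟨M, hM, hl⟩
    obtain ⟨r, hr, hMr⟩ := h M hM
    exact hMr (hl hr)
  · rintro ⟨M, hM, hl⟩
    obtain ⟨r, hr, hMr⟩ := h M hM.1
    exact hMr (hl ⟨hr, Weihrauch.Degree.hat_const r⟩)
  · rintro ⟨M, hM, hl⟩
    obtain ⟨r, hr, hMr⟩ := h M hM.1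
    exact hMr (hl ⟨hr, Weihrauch.Degree.star_const r⟩)
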